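/- Let $R$ be a unital associative ring and let $G$ be a group. For a monoid $S$, let $R$ denote the trivial left $R[S]$-module, on which every element of $S$ acts as the identity. A module is of type $\mathrm{FP}_n$ if it has a projective resolution $\cdots\to P_1\to P_0$ with $P_i$ finitely generated for all $i\leqslant n$, and of type $\mathrm{FP}$ if it has a projective resolution with all $P_i$ finitely generated and $P_i=0$ for all large $i$. The group $G$ is of type $\mathrm{FP}_n(R)$ (resp. $\mathrm{FP}(R)$) if the trivial $R[G]$-module $R$ is of type $\mathrm{FP}_n$ (resp. $\mathrm{FP}$), and $\mathrm{cd}_R(G)$ is the projective dimension of the trivial $R[G]$-module $R$. The group $G$ is homologically coherent over $R$ if every finitely generated subgroup of $G$ is of type $\mathrm{FP}_2(R)$. For a character $\chi\in H^1(G;\mathbb{R})=\mathrm{Hom}(G,\mathbb{R})$, let $G_\chi$ be the submonoid $\{g\in G:\chi(g)\geqslant 0\}$. The $i$th $\Sigma$-invariant of $G$ over $R$ is $$\Sigma^i(G;R)=\{\chi\in H^1(G;\mathbb{R})\smallsetminus\{0\} : \text{the trivial } R[G_\chi]\text{-module } R \text{ is of type } \mathrm{FP}_i\},$$ and $\Sigma^i_{\mathbb{Q}}(G;R)=\Sigma^i(G;R)\cap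 H^1(G;\mathbb{Q})$ is the set of those $\chi\in\Sigma^i(G;R)$ with $\chi(G)\subseteq\mathbb{Q}$. **Corollary.** If $G$ is of type $\mathrm{FP}(R)$, $\mathrm{cd}_R(G)\leqslant 2$, and $G$ is homologically coherent over $R$, then $$\Sigma^1_{\mathbb{Q}}(G;R)=\Sigma^2_{\mathbb{Q}}(G;R).$$ -/

import Mathlib

noncomputable section

namespace SigmaCoherence

universe u v w

/-! ### Projective resolutions and finiteness properties of modules -/

/-- A projective resolution `⋯ → P₂ → P₁ → P₀ → M → 0` of a left `A`-module `M`.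
The terms live in the universe of `A`; this is no restriction for the modules `M` used below,
whose universe is at most that of `A`. -/
structure ProjRes (A : Type u) [Ring A] (M : Type w) [AddCommGroup M] [Module A M] where
  /-- the terms of the resolution -/
  P : ℕ → Type u
  [addCommGroup : ∀ i, AddCommGroup (P i)]
  [module : ∀ i, Module A (P i)]
  /-- the boundary maps -/
  d : ∀ i, P (i + 1) →ₗ[A] P i
  /-- the augmentation onto the resolved module -/
  ε : P 0 →ₗ[A] M
  projective : ∀ i, Module.Projective A (P i)
  surjective : Function.Surjective ε
  exact_zero : Function.Exact (d 0) ε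
  exact_succ : ∀ i, Function.Exact (d (i + 1)) (d i)

attribute [instance] ProjRes.addCommGroup ProjRes.module

section Modules

variable (A : Type u) [Ring A] (M : Type w) [AddCommGroup M] [Module A M]

/-- `M` is of type `FP_n` over `A`. -/
def ModuleFPn (n : ℕ) : Prop :=
  ∃ P : ProjRes A M, ∀ i ≤ n, Module.Finite A (P.P i)

/-- `M` is of type `FP` over `A`. -/
def ModuleFP : Prop :=
  ∃ P : ProjRes A M, (∀ i, Module.Finite A (P.P i)) ∧ ∃ n₀ : ℕ, ∀ i ≥ n₀, Subsingleton (P.P i)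

/-- The projective dimension of `M` over `A`: the infimal length of a projective resolution
(`⊤` if there is no resolution of finite length). -/
def projDim : ℕ∞ :=
  ⨅ (n : ℕ) (_ : ∃ P : ProjRes A M, ∀ i > n, Subsingleton (P.P i)), (n : ℕ∞)

end Modules

/-! ### The trivial module over a monoid ring -/

section Trivial

variable (R : Type u) [Ring R] (S : Type v) [Monoid S]

/-- The augmentation `R[S] → R`, `∑ rₛ s ↦ ∑ rₛ`. -/
def augmentation : MonoidAlgebra R S →+* R :=
  MonoidAlgebra.liftNCRingHom (RingHom.id R) (1 : S →* R) (fun _ _ => Commute.one_right _)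

/-- The trivial left `R[S]`-module `R`, on which every element of `S` acts as the identity. -/
def TrivialModule (R : Type u) (_S : Type v) : Type u := R

instance : AddCommGroup (TrivialModule R S) := inferInstanceAs (AddCommGroup R)

instance : Module (MonoidAlgebra R S) (TrivialModule R S) :=
  Module.compHom R (augmentation R S)

end Trivial

/-! ### Finiteness properties of groups -/

section Groups

variable (R : Type u) [Ring R] (G : Type v) [Group G]

/-- `G` is of type `FP_n(R)`. -/
def GroupFPn (n : ℕ) : Prop :=
  ModuleFPn (MonoidAlgebra R G) (TrivialModule R G) n

/-- `G` is of type `FP(R)`. -/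
def GroupFP : Prop :=
  ModuleFP (MonoidAlgebra R G) (TrivialModule R G)

/-- The cohomological dimension `cd_R(G)`. -/
def cohomDim : ℕ∞ :=
  projDim (MonoidAlgebra R G) (TrivialModule R G)

/-- `G` is homologically coherent over `R`: every finitely generated subgroup is of type
`FP_2(R)`. -/
def HomologicallyCoherent : Prop :=
  ∀ H : Subgroup G, H.FG → GroupFPn R H 2

end Groups

/-! ### Characters and Sigma-invariants -/

section Sigma

variable {G : Type v} [Group G]

/-- The submonoid `G_χ = {g : χ(g) ≥ 0}` of `G`, for a real character `χ ∈ H¹(G; ℝ)`. -/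
def nonnegSubmonoid (χ : Additive G →+ ℝ) : Submonoid G where
  carrier := {g | 0 ≤ χ (Additive.ofMul g)}
  one_mem' := by simp
  mul_mem' := by
    intro a b ha hb
    simp only [Set.mem_ofPred_eq, ofMul_mul, map_add] at *
    exact add_nonneg ha hb

variable (R : Type u) [Ring R] (G)

/-- The `i`-th Sigma-invariant `Σⁱ(G; R)` of Bieri and Renz: the non-zero real characters `χ` of
`G` for which the trivial module `R` is of type `FP_i` over the monoid ring `R[G_χ]`. -/
def sigmaInv (i : ℕ) : Set (Additive G →+ ℝ) :=
  {χ | χ ≠ 0 ∧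
    ModuleFPn (MonoidAlgebra R (nonnegSubmonoid χ)) (TrivialModule R (nonnegSubmonoid χ)) i}

/-- `H¹(G; ℚ) ⊆ H¹(G; ℝ)`: the characters all of whose values are rational. -/
def rationalCharacters : Set (Additive G →+ ℝ) :=
  {χ | ∀ g, ∃ q : ℚ, χ g = (q : ℝ)}

/-- `Σⁱ_ℚ(G; R) = Σⁱ(G; R) ∩ H¹(G; ℚ)`. -/
def sigmaInvRat (i : ℕ) : Set (Additive G →+ ℝ) :=
  sigmaInv G R i ∩ rationalCharacters G

end Sigma

end SigmaCoherence

end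

noncomputable section

namespace SigmaCoherence

universe u v w

/-! ### Resolutions, finite presentation and Schanuel's lemma -/

section Resolutions

variable {A : Type u} [Ring A]

/-! Only the passage from `Σ¹` to `Σ²` has content. Put `S = G_χ`. Type `FP₁` yields a finite `T ⊆
S` whose elements `s - 1` generate the augmentation ideal `I` of `R[S]`. Hence a property that holds
at `1` and is both preserved and reflected by right multiplication by `T` holds on all of `S`
(`forall_of_augmentationIdeal_eq_span`). Applied to denominators of `χ`, this makes the image of `χ`
infinite cyclic, generated by some `χ(t) > 0`. Applied to the kernel of `χ`, it gives a finitely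
generated `B` inside the kernel with `t⁻¹Bt ≤ B`, such that every `s ∈ S` satisfies `s tᵐ = tⁿ b`
with `b ∈ B` (`exists_ascending_subgroup`).

Coherence makes `B` of type `FP₂`, so its augmentation ideal is finitely presented, and so is the
left ideal `J` it generates in `R[S]`, by freeness over `R[B]` (`finitePresentation_subgroupIdeal`).
The quotient `I/J` is generated by the class of `t - 1`. The annihilator of that class is exactly
`J`, because right multiplication by `t` strictly raises the `χ`-height of cosets of `B`. So `I/J ≅
R[S]/J` is finitely presented, hence so is its extension `I`, and the trivial module is of type
`FP₂` (`moduleFPn_two_of_ascending`). -/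

theorem exact_subtype_comp {X Y Z : Type*} [AddCommGroup X] [Module A X] [AddCommGroup Y]
    [Module A Y] [AddCommGroup Z] [Module A Z] (f : Y →ₗ[A] Z) (g : X →ₗ[A] LinearMap.ker f)
    (hg : Function.Surjective g) : Function.Exact ((LinearMap.ker f).subtype ∘ₗ g) f := by
  rw [LinearMap.exact_iff]
  exact (LinearMap.range_comp_of_range_eq_top _ (LinearMap.range_eq_top.2 hg)
    |>.trans (Submodule.range_subtype _)).symm

theorem exact_comp_subtype {W X Y Z : Type*} [AddCommGroup W] [Module A W] [AddCommGroup X]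
    [Module A X] [AddCommGroup Y] [Module A Y] [AddCommGroup Z] [Module A Z] (f : Y →ₗ[A] Z)
    (g : X →ₗ[A] LinearMap.ker f) {h : W →ₗ[A] X} (hg : Function.Exact h g) :
    Function.Exact h ((LinearMap.ker f).subtype ∘ₗ g) := by
  rw [LinearMap.exact_iff]
  exact (LinearMap.ker_comp_of_ker_eq_bot _ (Submodule.ker_subtype _)).trans
    (LinearMap.exact_iff.1 hg)

/-- The kernel of the canonical free cover of a module. -/
abbrev freeKer (A : Type u) [Ring A] (M : Type v) [AddCommGroup M] [Module A M] :
    Submodule A (M →₀ A) :=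
  LinearMap.ker (Finsupp.linearCombination A (id : M → M))

/-- The canonical map from the free cover of `freeKer A M` to the free cover of `M`. -/
def freeBoundary (A : Type u) [Ring A] (M : Type v) [AddCommGroup M] [Module A M] :
    (freeKer A M →₀ A) →ₗ[A] (M →₀ A) :=
  (freeKer A M).subtype ∘ₗ Finsupp.linearCombination A (id : freeKer A M → freeKer A M)

theorem freeBoundary_exact (M : Type v) [AddCommGroup M] [Module A M] :
    Function.Exact (freeBoundary A M) (Finsupp.linearCombination A (id : M → M)) :=
  exact_subtype_comp _ _ (Finsupp.linearCombination_id_surjective A _)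

theorem freeBoundary_exact_freeBoundary (M : Type v) [AddCommGroup M] [Module A M] :
    Function.Exact (freeBoundary A (freeKer A M)) (freeBoundary A M) :=
  exact_comp_subtype _ _ (freeBoundary_exact _)

/-- The iterated syzygies of a module with respect to its canonical free covers. -/
def freeSyzygy (M : ModuleCat.{u} A) : ℕ → ModuleCat.{u} A
  | 0 => M
  | n + 1 => ModuleCat.of A (freeKer A (freeSyzygy M n))

/-- The canonical free resolution of a module. -/
def freeResolution (M : Type u) [AddCommGroup M] [Module A M] : ProjRes A M where
  P i := freeSyzygy (ModuleCat.of A M) i →₀ A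
  d i := freeBoundary A (freeSyzygy (ModuleCat.of A M) i)
  ε := Finsupp.linearCombination A (id : M → M)
  projective _ := inferInstance
  surjective := Finsupp.linearCombination_id_surjective A M
  exact_zero := freeBoundary_exact M
  exact_succ i := freeBoundary_exact_freeBoundary (freeSyzygy (ModuleCat.of A M) i)

/-- The sequence of terms `P₀, Q 0, Q 1, …`. -/
def consTerm (P₀ : Type u) (Q : ℕ → Type u) : ℕ → Type u
  | 0 => P₀
  | i + 1 => Q i

instance (P₀ : Type u) (Q : ℕ → Type u) [AddCommGroup P₀] [∀ i, AddCommGroup (Q i)] :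
    ∀ i, AddCommGroup (consTerm P₀ Q i)
  | 0 => inferInstanceAs (AddCommGroup P₀)
  | i + 1 => inferInstanceAs (AddCommGroup (Q i))

instance (P₀ : Type u) (Q : ℕ → Type u) [AddCommGroup P₀] [∀ i, AddCommGroup (Q i)]
    [Module A P₀] [∀ i, Module A (Q i)] : ∀ i, Module A (consTerm P₀ Q i)
  | 0 => inferInstanceAs (Module A P₀)
  | i + 1 => inferInstanceAs (Module A (Q i))

/-- Splicing a resolution of the kernel of a surjection from a projective module. -/
def ProjRes.cons {M : Type w} [AddCommGroup M] [Module A M] {P₀ : Type u} [AddCommGroup P₀]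
    [Module A P₀] [hP₀ : Module.Projective A P₀] (f : P₀ →ₗ[A] M) (hf : Function.Surjective f)
    (Q : ProjRes A (LinearMap.ker f)) : ProjRes A M where
  P := consTerm P₀ Q.P
  d := fun
    | 0 => (LinearMap.ker f).subtype ∘ₗ Q.ε
    | i + 1 => Q.d i
  ε := f
  projective := fun
    | 0 => hP₀
    | i + 1 => Q.projective i
  surjective := hf
  exact_zero := exact_subtype_comp f Q.ε Q.surjective
  exact_succ := fun
    | 0 => exact_comp_subtype f Q.ε Q.exact_zero
    | i + 1 => Q.exact_succ i

variable {M : Type w} [AddCommGroup M] [Module A M]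

theorem ModuleFPn.mono {m n : ℕ} (hmn : m ≤ n) (h : ModuleFPn A M n) : ModuleFPn A M m :=
  h.imp fun _ hP i hi => hP i (hi.trans hmn)

theorem ModuleFPn.of_surjective {n : ℕ} {P₀ : Type u} [AddCommGroup P₀] [Module A P₀]
    [Module.Projective A P₀] [hfin : Module.Finite A P₀] (f : P₀ →ₗ[A] M) (hf : Function.Surjective f)
    (h : ModuleFPn A (LinearMap.ker f) n) : ModuleFPn A M (n + 1) := by
  obtain ⟨Q, hQ⟩ := h
  refine ⟨Q.cons f hf, fun i hi => ?_⟩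
  match i with
  | 0 => exact hfin
  | i + 1 => exact hQ i (by omega)

theorem moduleFPn_zero_of_finite [Module.Finite A M] : ModuleFPn A M 0 := by
  obtain ⟨n, f, hf⟩ := Module.Finite.exists_fin' A M
  refine ⟨(freeResolution (LinearMap.ker f)).cons f hf, fun i hi => ?_⟩
  obtain rfl : i = 0 := by omega
  have h : Module.Finite A (Fin n → A) := inferInstance
  exact h

theorem moduleFPn_one_of_finitePresentation [Module.FinitePresentation A M] :
    ModuleFPn A M 1 := by
  obtain ⟨n, f, hf⟩ := Module.Finite.exists_fin' A M
  have : Module.Finite A (LinearMap.ker f) := .of_fg (Module.FinitePresentation.fg_ker f hf)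
  exact .of_surjective f hf moduleFPn_zero_of_finite

/-- Every module over the zero ring is zero. The resolution is borrowed from `PUnit` because `M` may
live in another universe than `A`. -/
theorem moduleFPn_of_subsingleton_ring [Subsingleton A] (n : ℕ) : ModuleFPn A M n := by
  have : ∀ i, Subsingleton ((freeResolution (A := A) PUnit).P i) := fun i =>
    Module.subsingleton A _
  have : Subsingleton M := Module.subsingleton A M
  have hker : ∀ i, Module.Finite A ((freeResolution (A := A) PUnit).P i) := fun i =>
    inferInstance
  exact ⟨{ freeResolution (A := A) PUnit with
    ε := 0
    surjective := fun x => ⟨0, Subsingleton.elim _ _⟩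
    exact_zero := fun x => ⟨fun _ => ⟨0, Subsingleton.elim _ _⟩, fun _ => rfl⟩ }, fun i _ => hker i⟩

/-- The first boundary map, with codomain restricted to the kernel of the augmentation. -/
def ProjRes.toKer (P : ProjRes A M) : P.P 1 →ₗ[A] LinearMap.ker P.ε :=
  (P.d 0).codRestrict _ fun x => P.exact_zero.apply_apply_eq_zero x

theorem ProjRes.toKer_surjective (P : ProjRes A M) : Function.Surjective P.toKer := by
  rintro ⟨x, hx⟩
  obtain ⟨y, hy⟩ := (P.exact_zero x).1 hx
  exact ⟨y, Subtype.ext hy⟩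

theorem ProjRes.ker_toKer (P : ProjRes A M) :
    LinearMap.ker P.toKer = LinearMap.range (P.d 1) := by
  exact (LinearMap.ker_codRestrict _ _ _).trans (LinearMap.exact_iff.1 (P.exact_succ 0))

theorem ModuleFPn.finitePresentation (h : ModuleFPn A M 1) : Module.FinitePresentation A M := by
  obtain ⟨P, hP⟩ := h
  have := P.projective 0
  have := hP 0 (by omega)
  have := hP 1 le_rfl
  have := Module.finitePresentation_of_projective A (P.P 0)
  refine Module.finitePresentation_of_surjective P.ε P.surjective ?_
  rw [LinearMap.exact_iff.1 P.exact_zero]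
  exact Submodule.fg_range _

/-- **Schanuel's lemma** for finite presentation of kernels. -/
theorem finitePresentation_ker_of_surjective {P Q : Type*} [AddCommGroup P] [Module A P]
    [AddCommGroup Q] [Module A Q] [Module.Projective A P] [Module.Projective A Q]
    [Module.Finite A Q] (p : P →ₗ[A] M) (hp : Function.Surjective p)
    (q : Q →ₗ[A] M) (hq : Function.Surjective q) [Module.FinitePresentation A (LinearMap.ker p)] :
    Module.FinitePresentation A (LinearMap.ker q) := by
  -- The pullback of `p` and `q`: it is an extension of `Q` by `ker p`, hence finitely presented,
  -- and also an extension of the projective `P` by `ker q`, which is therefore a direct summand.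
  let X : Submodule A (P × Q) := LinearMap.eqLocus (p ∘ₗ LinearMap.fst A P Q)
    (q ∘ₗ LinearMap.snd A P Q)
  let a : X →ₗ[A] P := LinearMap.fst A P Q ∘ₗ X.subtype
  let b : X →ₗ[A] Q := LinearMap.snd A P Q ∘ₗ X.subtype
  have hX : ∀ x : X, p (a x) = q (b x) := fun x => x.2
  have ha : Function.Surjective a := fun x => by
    obtain ⟨y, hy⟩ := hq (p x)
    exact ⟨⟨(x, y), hy.symm⟩, rfl⟩
  have hb : Function.Surjective b := fun y => by
    obtain ⟨x, hx⟩ := hp (q y)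
    exact ⟨⟨(x, y), hx⟩, rfl⟩
  let e : LinearMap.ker p ≃ₗ[A] LinearMap.ker b := .ofBijective
    (LinearMap.codRestrict _ (LinearMap.codRestrict X
      (LinearMap.inl A P Q ∘ₗ (LinearMap.ker p).subtype)
      (fun x => by simp [X])) fun x => rfl)
    ⟨fun x y hxy => Subtype.ext (congrArg (fun z => z.1.1.1) hxy),
     fun ⟨x, hx⟩ => ⟨⟨a x, by
        have hx : b x = 0 := hx
        simp [hX, hx]⟩, Subtype.ext (Subtype.ext (Prod.ext rfl hx.symm))⟩⟩
  have : Module.FinitePresentation A (LinearMap.ker b) :=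
    Module.FinitePresentation.of_equiv (N := LinearMap.ker b) e
  have := Module.finitePresentation_of_projective A Q
  have : Module.FinitePresentation A X := Module.finitePresentation_of_ker b hb
  let i : LinearMap.ker q →ₗ[A] X := LinearMap.codRestrict X
      (LinearMap.inr A P Q ∘ₗ (LinearMap.ker q).subtype)
      (fun x => by simp [X])
  refine Module.finitePresentation_of_projective_of_exact i a
    (fun x y hxy => Subtype.ext (congrArg (fun z => z.1.2) hxy)) ha fun x => ⟨fun hx => ?_, ?_⟩
  · exact ⟨⟨b x, by simp [← hX, hx]⟩, Subtype.ext (Prod.ext hx.symm rfl)⟩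
  · rintro ⟨y, rfl⟩
    rfl

/-- The given resolution presents the kernel of its own augmentation; Schanuel's lemma transfers
this to an arbitrary finite projective cover, such as the group ring. -/
theorem ModuleFPn.finitePresentation_ker (h : ModuleFPn A M 2) {Q : Type*} [AddCommGroup Q]
    [Module A Q] [Module.Projective A Q] [Module.Finite A Q] (q : Q →ₗ[A] M)
    (hq : Function.Surjective q) : Module.FinitePresentation A (LinearMap.ker q) := by
  obtain ⟨P, hP⟩ := h
  have := P.projective
  have := hP 1 (by omega)
  have := hP 2 le_rfl
  have := Module.finitePresentation_of_projective A (P.P 1)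
  have : Module.FinitePresentation A (LinearMap.ker P.ε) := by
    refine Module.finitePresentation_of_surjective P.toKer P.toKer_surjective ?_
    rw [P.ker_toKer]
    exact Submodule.fg_range _
  exact finitePresentation_ker_of_surjective P.ε P.surjective q hq

end Resolutions

/-! ### Extension of finitely presented left ideals along a free ring extension -/

section BaseChange

variable {A₀ : Type u} {A : Type v} [Ring A₀] [Ring A]

/-- If `A` is free as a right `A₀`-module (witnessed by elements `e q` and coordinate maps `D`),
then a finitely presented left ideal of `A₀` generates a finitely presented left ideal of `A`. -/
theorem finitePresentation_span_image (ι : A₀ →+* A) {Q : Type*} (e : Q → A)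
    (D : A →+ (Q →₀ A₀)) (hD : ∀ a, ((D a).sum fun q w => e q * ι w) = a)
    (hmul : ∀ a c q, D (a * ι c) q = D a q * c) (J : Submodule A₀ A₀)
    [Module.FinitePresentation A₀ J] :
    Module.FinitePresentation A (Submodule.span A (ι '' (J : Set A₀))) := by
  classical
  obtain ⟨n, g, hg⟩ := Module.Finite.exists_fin' A₀ J
  let j : Fin n → A₀ := fun i => g (Pi.single i 1)
  have hgj : ∀ w, (g w : A₀) = ∑ i, w i * j i := fun w => by
    conv_lhs => rw [← Finset.univ_sum_single w]
    rw [map_sum, Submodule.coe_sum]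
    refine Finset.sum_congr rfl fun i _ => ?_
    rw [show Pi.single i (w i) = w i • (Pi.single i 1 : Fin n → A₀) by
      rw [← Pi.single_smul, smul_eq_mul, mul_one], map_smul]
    rfl
  let f : (Fin n → A) →ₗ[A] A := Fintype.linearCombination A (fun i => ι (j i))
  have hf : ∀ v, f v = ∑ i, v i * ι (j i) := fun v => rfl
  have hrange : LinearMap.range f = Submodule.span A (ι '' (J : Set A₀)) := by
    rw [Fintype.range_linearCombination]
    apply le_antisymm <;> rw [Submodule.span_le]
    · rintro _ ⟨i, rfl⟩
      exact Submodule.subset_span ⟨j i, (g _).2, rfl⟩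
    · rintro _ ⟨x, hx, rfl⟩
      obtain ⟨w, hw⟩ := hg ⟨x, hx⟩
      have : x = ∑ i, w i * j i := by rw [← hgj, hw]
      rw [this, map_sum]
      refine Submodule.sum_mem _ fun i _ => ?_
      rw [map_mul]
      exact Submodule.smul_mem _ _ (Submodule.subset_span ⟨i, rfl⟩)
  obtain ⟨T, hT⟩ := Module.FinitePresentation.fg_ker g hg
  let φ : (Fin n → A₀) → (Fin n → A) := fun w i => ι (w i)
  have hφ : ∀ w ∈ LinearMap.ker g, φ w ∈ Submodule.span A (φ '' (T : Set (Fin n → A₀))) := by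
    intro w hw
    rw [← hT] at hw
    induction hw using Submodule.span_induction with
    | mem x hx => exact Submodule.subset_span ⟨x, hx, rfl⟩
    | zero =>
      convert Submodule.zero_mem _
      ext i
      exact map_zero ι
    | add x y _ _ hx hy =>
      convert Submodule.add_mem _ hx hy
      ext i
      exact map_add ι _ _
    | smul c x _ hx =>
      convert Submodule.smul_mem _ (ι c) hx
      ext i
      exact map_mul ι _ _
  have hker : LinearMap.ker f = Submodule.span A (φ '' (T : Set (Fin n → A₀))) := by
    apply le_antisymm
    · intro v hv
      -- A relation `v` over `A` is cut into its coordinate slices `w q`. Right linearity of `D`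
      -- makes each slice a relation over `A₀`, so the finitely many relations `T` over `A₀` suffice
      -- over `A`.
      let F : Finset Q := Finset.univ.biUnion fun i => (D (v i)).support
      let w : Q → Fin n → A₀ := fun q i => D (v i) q
      have hw : ∀ q, w q ∈ LinearMap.ker g := fun q => by
        have : f v = 0 := hv
        rw [LinearMap.mem_ker, ← Subtype.coe_inj, hgj, Submodule.coe_zero]
        calc ∑ i, w q i * j i = D (f v) q := by
              rw [hf, map_sum, Finsupp.finsetSum_apply]
              exact Finset.sum_congr rfl fun i _ => (hmul _ _ _).symm
          _ = 0 := by rw [this]; simp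
      have : v = ∑ q ∈ F, e q • φ (w q) := by
        ext i
        rw [Finset.sum_apply]
        conv_lhs => rw [← hD (v i)]
        refine Finsupp.sum_of_support_subset _ ?_ _ fun q _ => by simp
        exact Finset.subset_biUnion_of_mem (fun i => (D (v i)).support) (Finset.mem_univ i)
      rw [this]
      exact Submodule.sum_mem _ fun q _ => Submodule.smul_mem _ _ (hφ _ (hw q))
    · rw [Submodule.span_le]
      rintro _ ⟨w, hw, rfl⟩
      have hw : g w = 0 := by
        have : w ∈ LinearMap.ker g := hT ▸ Submodule.subset_span hw
        exact this
      change f (φ w) = 0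
      calc f (φ w) = ι (g w) := by rw [hf, hgj, map_sum]; simp [φ]
        _ = 0 := by simp [hw]
  rw [← hrange]
  refine Module.finitePresentation_of_surjective f.rangeRestrict f.surjective_rangeRestrict ?_
  rw [LinearMap.ker_rangeRestrict, hker]
  exact Submodule.fg_span (T.finite_toSet.image _)

end BaseChange

/-! ### Augmentation ideals and the saturation principle -/

section Augmentation

variable (R : Type u) [Ring R] (S : Type v) [Monoid S]

@[simp]
theorem augmentation_single (s : S) (r : R) :
    augmentation R S (MonoidAlgebra.single s r) = r := by
  simp [augmentation]

/-- The augmentation as a linear map onto the trivial module. -/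
def augmentationLinear : MonoidAlgebra R S →ₗ[MonoidAlgebra R S] TrivialModule R S where
  toFun a := augmentation R S a
  map_add' := map_add _
  map_smul' a b := map_mul (augmentation R S) a b

theorem augmentationLinear_surjective : Function.Surjective (augmentationLinear R S) :=
  fun r => ⟨MonoidAlgebra.single 1 r, augmentation_single R S 1 r⟩

/-- The augmentation ideal, as a left ideal. -/
abbrev augmentationIdeal : Submodule (MonoidAlgebra R S) (MonoidAlgebra R S) :=
  LinearMap.ker (augmentationLinear R S)

variable {R S}

theorem mem_augmentationIdeal {a : MonoidAlgebra R S} :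
    a ∈ augmentationIdeal R S ↔ augmentation R S a = 0 := Iff.rfl

theorem of_sub_one_mem_augmentationIdeal (s : S) :
    MonoidAlgebra.of R S s - 1 ∈ augmentationIdeal R S := by
  rw [mem_augmentationIdeal]
  simp

theorem augmentationIdeal_eq_span :
    augmentationIdeal R S =
      Submodule.span _ (Set.range fun s => MonoidAlgebra.of R S s - 1) := by
  apply le_antisymm
  · have key : ∀ a : MonoidAlgebra R S, a - MonoidAlgebra.single 1 (augmentation R S a) ∈
        Submodule.span (MonoidAlgebra R S) (Set.range fun s => MonoidAlgebra.of R S s - 1) := by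
      intro a
      induction a using MonoidAlgebra.induction_linear with
      | zero => simp
      | add x y hx hy =>
        rw [map_add, MonoidAlgebra.single_add, add_sub_add_comm]
        exact Submodule.add_mem _ hx hy
      | single s r =>
        have : MonoidAlgebra.single s r - MonoidAlgebra.single 1 r =
            MonoidAlgebra.single (1 : S) r • (MonoidAlgebra.of R S s - 1) := by
          simp [mul_sub, MonoidAlgebra.single_mul_single]
        rw [augmentation_single, this]
        exact Submodule.smul_mem _ _ (Submodule.subset_span ⟨s, rfl⟩)
    intro a ha
    have := key a
    rwa [mem_augmentationIdeal.1 ha, MonoidAlgebra.single_zero, sub_zero] at this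
  · rw [Submodule.span_le]
    rintro _ ⟨s, rfl⟩
    exact of_sub_one_mem_augmentationIdeal s

/-- If the trivial module is of type `FP₁`, the augmentation ideal is generated by finitely many
elements of the form `s - 1`. -/
theorem exists_finset_augmentationIdeal_eq_span
    (h : ModuleFPn (MonoidAlgebra R S) (TrivialModule R S) 1) :
    ∃ T : Finset S, augmentationIdeal R S =
      Submodule.span _ ((fun s => MonoidAlgebra.of R S s - 1) '' (T : Set S)) := by
  classical
  have := h.finitePresentation
  have hfg : (augmentationIdeal R S).FG := Module.FinitePresentation.fg_ker
    (augmentationLinear R S) (augmentationLinear_surjective R S)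
  rw [augmentationIdeal_eq_span, Submodule.fg_span_iff_fg_span_finset_subset] at hfg
  obtain ⟨T, hT, hspan⟩ := hfg
  rw [← Set.image_univ, Finset.subset_set_image_iff] at hT
  obtain ⟨T', -, rfl⟩ := hT
  exact ⟨T', by rw [augmentationIdeal_eq_span, hspan, Finset.coe_image]⟩

/-- A subset of `S` that contains `1` and is saturated under right multiplication by elements `s`
for which the `s - 1` generate the augmentation ideal is all of `S`. -/
theorem forall_of_augmentationIdeal_eq_span [Nontrivial R] {T : Set S}
    (hT : augmentationIdeal R S =
      Submodule.span _ ((fun s => MonoidAlgebra.of R S s - 1) '' T))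
    (Q : S → Prop) (h1 : Q 1) (hQ : ∀ x, ∀ s ∈ T, Q (x * s) ↔ Q x) (y : S) : Q y := by
  classical
  -- `φ` sums the coefficients at elements satisfying `Q`. It kills every `x (s - 1)` with `s ∈ T`,
  -- hence also `y - 1`; as `1 ≠ 0` in `R`, this forces `Q y`.
  let φ : MonoidAlgebra R S →+ R := MonoidAlgebra.liftNC (AddMonoidHom.id R)
    fun s => if Q s then 1 else 0
  have hφ : ∀ s r, φ (MonoidAlgebra.single s r) = if Q s then r else 0 := fun s r => by
    simp [φ]
  have key : ∀ a ∈ augmentationIdeal R S, φ a = 0 := by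
    intro a ha
    rw [hT] at ha
    refine Submodule.closure_induction (p := fun a _ => φ a = 0) (map_zero φ)
      (fun x y _ _ hx hy => by rw [map_add, hx, hy, add_zero]) ?_ ha
    rintro x _ ⟨s, hs, rfl⟩
    induction x using MonoidAlgebra.induction_linear with
    | zero => simp
    | add x y hx hy => rw [add_smul, map_add, hx, hy, add_zero]
    | single x r =>
      rw [smul_eq_mul, mul_sub, mul_one, MonoidAlgebra.of_apply, MonoidAlgebra.single_mul_single,
        map_sub, hφ, hφ, mul_one]
      simp [hQ x s hs]
  have := key _ (of_sub_one_mem_augmentationIdeal y)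
  rw [MonoidAlgebra.of_apply, MonoidAlgebra.one_def, map_sub, hφ, hφ, if_pos h1] at this
  by_contra hy
  simp [hy] at this

end Augmentation

/-! ### The left ideal of `R[S]` induced from a subgroup -/

section Induced

variable (R : Type u) [Ring R] {G : Type v} [Group G] (S : Submonoid G) (B : Subgroup G)
  (hB : ∀ b ∈ B, b ∈ S)

/-- The inclusion of a subgroup into a submonoid containing it. -/
def subgroupInclusion : B →* S where
  toFun b := ⟨b, hB b b.2⟩
  map_one' := rfl
  map_mul' _ _ := rfl

/-- The homomorphism of monoid rings induced by the inclusion of a subgroup. -/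
def inducedHom : MonoidAlgebra R B →+* MonoidAlgebra R S :=
  MonoidAlgebra.mapDomainRingHom R (subgroupInclusion S B hB)

theorem inducedHom_single (b : B) (r : R) :
    inducedHom R S B hB (MonoidAlgebra.single b r) =
      MonoidAlgebra.single (⟨b, hB b b.2⟩ : S) r :=
  MonoidAlgebra.mapDomain_single

/-- The left ideal of `R[S]` generated by the elements `b - 1`, `b ∈ B`. -/
def subgroupIdeal : Submodule (MonoidAlgebra R S) (MonoidAlgebra R S) :=
  Submodule.span _ (Set.range fun b : B => MonoidAlgebra.of R S ⟨b, hB b b.2⟩ - 1)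

theorem span_image_augmentationIdeal :
    Submodule.span (MonoidAlgebra R S)
      (inducedHom R S B hB '' (augmentationIdeal R B : Set (MonoidAlgebra R B))) =
      subgroupIdeal R S B hB := by
  have hof : ∀ b : B, inducedHom R S B hB (MonoidAlgebra.of R B b - 1) =
      MonoidAlgebra.of R S ⟨b, hB b b.2⟩ - 1 := fun b => by
    rw [map_sub, map_one, MonoidAlgebra.of_apply, inducedHom_single, MonoidAlgebra.of_apply]
  apply le_antisymm <;> rw [subgroupIdeal, Submodule.span_le]
  · rintro _ ⟨a, ha, rfl⟩
    replace ha : a ∈ augmentationIdeal R B := ha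
    rw [augmentationIdeal_eq_span] at ha
    induction ha using Submodule.span_induction with
    | mem x hx =>
      obtain ⟨b, rfl⟩ := hx
      rw [hof]
      exact Submodule.subset_span ⟨b, rfl⟩
    | zero => simp
    | add x y _ _ hx hy => rw [map_add]; exact Submodule.add_mem _ hx hy
    | smul c x _ hx =>
      rw [smul_eq_mul, map_mul]
      exact Submodule.smul_mem _ _ hx
  · rintro _ ⟨b, rfl⟩
    exact Submodule.subset_span ⟨_, of_sub_one_mem_augmentationIdeal b, hof b⟩

/-- The coset decomposition of `R[S]` as a right `R[B]`-module. -/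
def cosetCoordinates : MonoidAlgebra R S →+ ((G ⧸ B) →₀ MonoidAlgebra R B) :=
  (Finsupp.liftAddHom fun s : S => (Finsupp.singleAddHom ((s : G) : G ⧸ B)).comp
    (MonoidAlgebra.singleAddHom
      (⟨((s : G) : G ⧸ B).out⁻¹ * s, QuotientGroup.eq.1 (QuotientGroup.out_eq' _)⟩ : B))).comp
    MonoidAlgebra.coeffAddEquiv.toAddMonoidHom

theorem cosetCoordinates_single (s : S) (r : R) :
    cosetCoordinates R S B (MonoidAlgebra.single s r) =
      Finsupp.single ((s : G) : G ⧸ B) (MonoidAlgebra.single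
        (⟨((s : G) : G ⧸ B).out⁻¹ * s, QuotientGroup.eq.1 (QuotientGroup.out_eq' _)⟩ : B) r) := by
  simp [cosetCoordinates]

theorem cosetCoordinates_mul (a : MonoidAlgebra R S) (c : MonoidAlgebra R B) (q : G ⧸ B) :
    cosetCoordinates R S B (a * inducedHom R S B hB c) q = cosetCoordinates R S B a q * c := by
  induction a using MonoidAlgebra.induction_linear with
  | zero => simp
  | add x y hx hy => simp [add_mul, hx, hy]
  | single s r =>
    induction c using MonoidAlgebra.induction_linear with
    | zero => simp
    | add x y hx hy => simp only [map_add, mul_add, Finsupp.add_apply, hx, hy]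
    | single b r' =>
      have hq : (((s : G) * b : G) : G ⧸ B) = ((s : G) : G ⧸ B) :=
        QuotientGroup.mk_mul_of_mem _ b.2
      rw [inducedHom_single, MonoidAlgebra.single_mul_single, cosetCoordinates_single,
        cosetCoordinates_single]
      by_cases h : ((s : G) : G ⧸ B) = q
      · subst h
        simp only [Submonoid.coe_mul, hq, Finsupp.single_eq_same, MonoidAlgebra.single_mul_single]
        congr 1
        exact Subtype.ext (by simp [mul_assoc])
      · rw [Finsupp.single_eq_of_ne (by simpa [hq] using Ne.symm h),
          Finsupp.single_eq_of_ne (Ne.symm h), zero_mul]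

/-- The representative differs from `s` by a right factor in `B ≤ S`. -/
theorem out_mem (h : ∀ b ∈ B, b ∈ S) (s : S) : ((s : G) : G ⧸ B).out ∈ S := by
  obtain ⟨b, hb⟩ := QuotientGroup.mk_out_eq_mul B (s : G)
  rw [hb]
  exact S.mul_mem s.2 (h b b.2)

/-- The chosen representative of a coset, where it lies in `S`. -/
def cosetRep (q : G ⧸ B) : MonoidAlgebra R S :=
  -- The value `0` is harmless: coordinates of elements of `R[S]` live on cosets meeting `S`, where
  -- `out_mem` applies.
  open Classical in if h : q.out ∈ S then MonoidAlgebra.of R S ⟨q.out, h⟩ else 0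

theorem cosetRep_mk (h : ∀ b ∈ B, b ∈ S) (s : S) :
    cosetRep R S B ((s : G) : G ⧸ B) = MonoidAlgebra.of R S ⟨_, out_mem S B h s⟩ :=
  dif_pos _

theorem sum_cosetCoordinates (a : MonoidAlgebra R S) :
    ((cosetCoordinates R S B a).sum fun q w => cosetRep R S B q * inducedHom R S B hB w) = a := by
  induction a using MonoidAlgebra.induction_linear with
  | zero => simp
  | add x y hx hy =>
    rw [map_add, Finsupp.sum_add_index' (by simp) (by simp [mul_add]), hx, hy]
  | single s r =>
    rw [cosetCoordinates_single, Finsupp.sum_single_index (by simp), cosetRep_mk R S B hB,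
      inducedHom_single, MonoidAlgebra.of_apply, MonoidAlgebra.single_mul_single, one_mul]
    congr 1
    exact Subtype.ext (by simp)

/-- If `B` is of type `FP₂`, then `R[S]·(augmentation ideal of R[B])` is finitely presented. -/
theorem finitePresentation_subgroupIdeal (h : GroupFPn R B 2) :
    Module.FinitePresentation (MonoidAlgebra R S) (subgroupIdeal R S B hB) := by
  have : Module.FinitePresentation (MonoidAlgebra R B) (augmentationIdeal R B) :=
    ModuleFPn.finitePresentation_ker h (augmentationLinear R B) (augmentationLinear_surjective R B)
  rw [← span_image_augmentationIdeal]
  exact finitePresentation_span_image (inducedHom R S B hB) (cosetRep R S B)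
    (cosetCoordinates R S B) (sum_cosetCoordinates R S B hB) (cosetCoordinates_mul R S B hB) _

/-- The projection of `R[S]` onto the free module on the cosets of `B`. -/
def cosetProj : MonoidAlgebra R S →+ ((G ⧸ B) →₀ R) :=
  (Finsupp.liftAddHom fun s : S => Finsupp.singleAddHom ((s : G) : G ⧸ B)).comp
    MonoidAlgebra.coeffAddEquiv.toAddMonoidHom

theorem cosetProj_single (s : S) (r : R) :
    cosetProj R S B (MonoidAlgebra.single s r) = Finsupp.single ((s : G) : G ⧸ B) r := by
  simp [cosetProj]

/-- Identifies the quotient by the ideal with finitely supported functions on cosets, so that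
membership can be tested on supports. -/
theorem mem_subgroupIdeal_iff (a : MonoidAlgebra R S) :
    a ∈ subgroupIdeal R S B hB ↔ cosetProj R S B a = 0 := by
  constructor
  · intro ha
    refine Submodule.closure_induction (p := fun a _ => cosetProj R S B a = 0) (map_zero _)
      (fun x y _ _ hx hy => by rw [map_add, hx, hy, add_zero]) ?_ ha
    rintro x _ ⟨b, rfl⟩
    induction x using MonoidAlgebra.induction_linear with
    | zero => simp
    | add x y hx hy => rw [add_smul, map_add, hx, hy, add_zero]
    | single x r =>
      rw [smul_eq_mul, mul_sub, mul_one, MonoidAlgebra.of_apply, MonoidAlgebra.single_mul_single,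
        map_sub, cosetProj_single, cosetProj_single, mul_one, Submonoid.coe_mul,
        QuotientGroup.mk_mul_of_mem _ b.2, sub_self]
  · intro ha
    -- Modulo the ideal, `a` is the combination of coset representatives prescribed by its
    -- projection.
    have key : ∀ a : MonoidAlgebra R S, a - ((cosetProj R S B a).sum fun q r =>
        MonoidAlgebra.single 1 r * cosetRep R S B q) ∈ subgroupIdeal R S B hB := by
      intro a
      induction a using MonoidAlgebra.induction_linear with
      | zero => simp
      | add x y hx hy =>
        rw [map_add, Finsupp.sum_add_index' (by simp)
          (by simp [MonoidAlgebra.single_add, add_mul]), add_sub_add_comm]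
        exact Submodule.add_mem _ hx hy
      | single s r =>
        rw [cosetProj_single, Finsupp.sum_single_index (by simp), cosetRep_mk R S B hB]
        let b : B := ⟨((s : G) : G ⧸ B).out⁻¹ * s, QuotientGroup.eq.1 (QuotientGroup.out_eq' _)⟩
        have hs : s = ⟨_, out_mem S B hB s⟩ * ⟨b, hB b b.2⟩ := Subtype.ext (by simp [b])
        have : MonoidAlgebra.single s r - MonoidAlgebra.single 1 r *
            MonoidAlgebra.of R S ⟨_, out_mem S B hB s⟩ =
            (MonoidAlgebra.single 1 r * MonoidAlgebra.of R S ⟨_, out_mem S B hB s⟩) •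
              (MonoidAlgebra.of R S ⟨b, hB b b.2⟩ - 1) := by
          rw [smul_eq_mul, mul_sub, mul_one, mul_assoc, ← map_mul, ← hs]
          simp [MonoidAlgebra.single_mul_single]
        rw [this]
        exact Submodule.smul_mem _ _ (Submodule.subset_span ⟨b, rfl⟩)
    simpa [ha] using key a

end Induced

/-! ### Type `FP₂` for the monoid ring from an ascending subgroup -/

section Ascending

variable (R : Type u) [Ring R] {G : Type v} [Group G] (S : Submonoid G) (B : Subgroup G)
  (hB : ∀ b ∈ B, b ∈ S) (χ : Additive G →+ ℝ) (hχB : ∀ b ∈ B, χ (Additive.ofMul b) = 0)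
  (t : G) (htB : ∀ b ∈ B, t⁻¹ * b * t ∈ B)

/-- Right multiplication by `t` on the cosets of `B`, where `t⁻¹Bt ≤ B`. -/
def cosetMul (q : G ⧸ B) : G ⧸ B :=
  Quotient.map' (fun g => g * t) (fun a b hab => by
    rw [QuotientGroup.leftRel_apply] at hab ⊢
    have := htB _ hab
    simpa [mul_assoc] using this) q

/-- The value of a character on a coset of a subgroup of its kernel. -/
def cosetHeight (q : G ⧸ B) : ℝ :=
  Quotient.liftOn' q (fun g => χ (Additive.ofMul g)) (fun a b hab => by
    rw [QuotientGroup.leftRel_apply] at hab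
    have := hχB _ hab
    rw [ofMul_mul, map_add, ofMul_inv, map_neg] at this
    linarith)

theorem cosetHeight_cosetMul (q : G ⧸ B) :
    cosetHeight B χ hχB (cosetMul B t htB q) =
      cosetHeight B χ hχB q + χ (Additive.ofMul t) := by
  induction q using QuotientGroup.induction_on with
  | H g => exact map_add χ (Additive.ofMul g) (Additive.ofMul t)

theorem cosetProj_mul_of (ht : t ∈ S) (a : MonoidAlgebra R S) :
    cosetProj R S B (a * MonoidAlgebra.of R S ⟨t, ht⟩) =
      (cosetProj R S B a).mapDomain (cosetMul B t htB) := by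
  induction a using MonoidAlgebra.induction_linear with
  | zero => simp
  | add x y hx hy => rw [add_mul, map_add, hx, hy, map_add, Finsupp.mapDomain_add]
  | single s r =>
    rw [MonoidAlgebra.of_apply, MonoidAlgebra.single_mul_single, cosetProj_single,
      cosetProj_single, Finsupp.mapDomain_single, mul_one]
    rfl

/-- A finitely supported function invariant under pushforward along a map that strictly increases
a height function vanishes. -/
theorem eq_zero_of_mapDomain_eq {X : Type*} (f : X →₀ R) (τ : X → X) (ht : X → ℝ)
    (hτ : ∀ x, ht x < ht (τ x)) (h : f.mapDomain τ = f) : f = 0 := by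
  classical
  by_contra hf
  obtain ⟨x, hx, hmin⟩ := f.support.exists_min_image ht (Finsupp.support_nonempty_iff.2 hf)
  have : x ∈ f.support.image τ := Finsupp.mapDomain_support (by rwa [h])
  obtain ⟨y, hy, rfl⟩ := Finset.mem_image.1 this
  exact absurd (hmin y hy) (not_le.2 (hτ y))

/-- If `a (t - 1)` lies in the ideal, the coset projection of `a` is invariant under right
translation by `t`; translation raises height by `χ(t) > 0`, so a finitely supported invariant
function is zero. -/
theorem mul_of_sub_one_mem_subgroupIdeal_iff (hχ : ∀ b ∈ B, χ (Additive.ofMul b) = 0)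
    (hconj : ∀ b ∈ B, t⁻¹ * b * t ∈ B) (ht : t ∈ S) (htpos : 0 < χ (Additive.ofMul t))
    (a : MonoidAlgebra R S) :
    a * (MonoidAlgebra.of R S ⟨t, ht⟩ - 1) ∈ subgroupIdeal R S B hB ↔
      a ∈ subgroupIdeal R S B hB := by
  rw [mem_subgroupIdeal_iff, mem_subgroupIdeal_iff, mul_sub, mul_one, map_sub,
    cosetProj_mul_of R S B t hconj, sub_eq_zero]
  refine ⟨fun h => eq_zero_of_mapDomain_eq R _ _ (cosetHeight B χ hχ) (fun q => ?_) h,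
    fun h => by simp [h]⟩
  rw [cosetHeight_cosetMul]
  linarith

theorem augmentationIdeal_eq_sup (ht : t ∈ S)
    (hS : ∀ s ∈ S, ∃ n m : ℕ, ∃ b ∈ B, s * t ^ m = t ^ n * b) :
    augmentationIdeal R S =
      Submodule.span _ {MonoidAlgebra.of R S ⟨t, ht⟩ - 1} ⊔ subgroupIdeal R S B hB := by
  set X := Submodule.span (MonoidAlgebra R S) {MonoidAlgebra.of R S ⟨t, ht⟩ - 1} ⊔
    subgroupIdeal R S B hB with hX
  apply le_antisymm
  · have hb : ∀ (b : B) (x : MonoidAlgebra R S),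
        x * MonoidAlgebra.of R S ⟨b, hB b b.2⟩ - x ∈ X := fun b x => by
      have := X.smul_mem x ((le_sup_right : subgroupIdeal R S B hB ≤ X)
        (Submodule.subset_span ⟨b, rfl⟩))
      rwa [smul_eq_mul, mul_sub, mul_one] at this
    have ht' : ∀ x : MonoidAlgebra R S, x * MonoidAlgebra.of R S ⟨t, ht⟩ - x ∈ X := fun x => by
      have := X.smul_mem x ((le_sup_left : Submodule.span _ _ ≤ X)
        (Submodule.mem_span_singleton_self (MonoidAlgebra.of R S ⟨t, ht⟩ - 1)))
      rwa [smul_eq_mul, mul_sub, mul_one] at this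
    have hpow : ∀ (n : ℕ) (x : MonoidAlgebra R S),
        x * MonoidAlgebra.of R S ⟨t, ht⟩ ^ n - x ∈ X := fun n x => by
      induction n with
      | zero => simp
      | succ n ih =>
        rw [pow_succ, ← mul_assoc]
        simpa using X.add_mem (ht' (x * MonoidAlgebra.of R S ⟨t, ht⟩ ^ n)) ih
    rw [augmentationIdeal_eq_span, Submodule.span_le]
    rintro _ ⟨s, rfl⟩
    obtain ⟨n, m, b, hbB, h⟩ := hS s s.2
    have hs : s * ⟨t, ht⟩ ^ m = (⟨t, ht⟩ : S) ^ n * ⟨b, hB b hbB⟩ := Subtype.ext h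
    have hs' := congrArg (MonoidAlgebra.of R S) hs
    rw [map_mul, map_mul, map_pow, map_pow] at hs'
    -- With `s tᵐ = tⁿ b`, one has `s - 1 = (tⁿ b - tⁿ) - (s tᵐ - s) + (tⁿ - 1)`.
    have h1 := hpow m (MonoidAlgebra.of R S s)
    have h2 := hb ⟨b, hbB⟩ (MonoidAlgebra.of R S ⟨t, ht⟩ ^ n)
    have h3 := hpow n 1
    rw [hs'] at h1
    rw [one_mul] at h3
    have := X.add_mem (X.sub_mem h2 h1) h3
    simpa using this
  · refine sup_le (Submodule.span_le.2 ?_) (Submodule.span_le.2 ?_)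
    · rintro _ rfl
      exact of_sub_one_mem_augmentationIdeal _
    · rintro _ ⟨b, rfl⟩
      exact of_sub_one_mem_augmentationIdeal _

/-- The trivial `R[S]`-module is of type `FP₂` when `S` is an ascending union of translates of a
subgroup `B` of type `FP₂`. -/
theorem moduleFPn_two_of_ascending (hBS : ∀ b ∈ B, b ∈ S)
    (hχ : ∀ b ∈ B, χ (Additive.ofMul b) = 0) (hconj : ∀ b ∈ B, t⁻¹ * b * t ∈ B)
    (ht : t ∈ S) (htpos : 0 < χ (Additive.ofMul t))
    (hS : ∀ s ∈ S, ∃ n m : ℕ, ∃ b ∈ B, s * t ^ m = t ^ n * b) (h : GroupFPn R B 2) :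
    ModuleFPn (MonoidAlgebra R S) (TrivialModule R S) 2 := by
  set I := augmentationIdeal R S
  set J := subgroupIdeal R S B hBS with hJdef
  have hIsup : I = _ ⊔ J := augmentationIdeal_eq_sup R S B hBS t ht hS
  have hJI : J ≤ I := hIsup ▸ le_sup_right
  have hJ : Module.FinitePresentation (MonoidAlgebra R S) J :=
    finitePresentation_subgroupIdeal R S B hBS h
  let J' : Submodule (MonoidAlgebra R S) I := J.comap I.subtype
  have hJ' : Module.FinitePresentation (MonoidAlgebra R S) J' :=
    Module.FinitePresentation.of_equiv (N := J') (Submodule.comapSubtypeEquivOfLe hJI).symm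
  let y : I := ⟨MonoidAlgebra.of R S ⟨t, ht⟩ - 1, of_sub_one_mem_augmentationIdeal _⟩
  let l : MonoidAlgebra R S →ₗ[MonoidAlgebra R S] I ⧸ J' :=
    J'.mkQ ∘ₗ LinearMap.toSpanSingleton _ I y
  have hl : Function.Surjective l := by
    intro z
    obtain ⟨⟨x, hx⟩, rfl⟩ := J'.mkQ_surjective z
    have hx' := hx
    rw [hIsup, Submodule.mem_sup] at hx'
    obtain ⟨a, ha, j, hj, hxa⟩ := hx'
    obtain ⟨c, rfl⟩ := Submodule.mem_span_singleton.1 ha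
    refine ⟨c, (Submodule.Quotient.eq J').2 ?_⟩
    change c • (MonoidAlgebra.of R S ⟨t, ht⟩ - 1) - x ∈ J
    rw [← hxa, sub_add_cancel_left]
    exact J.neg_mem hj
  -- The annihilator of the class of `t - 1` is `J` itself, so `I/J ≅ R[S]/J`; finite generation of
  -- `J` then presents this quotient.
  have hker : LinearMap.ker l = J := by
    ext a
    rw [LinearMap.mem_ker]
    exact (Submodule.Quotient.mk_eq_zero J').trans
      (mul_of_sub_one_mem_subgroupIdeal_iff R S B hBS χ t hχ hconj ht htpos a)
  have hQ : Module.FinitePresentation (MonoidAlgebra R S) (I ⧸ J') := by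
    refine Module.finitePresentation_of_surjective l hl ?_
    rw [hker]
    exact Module.Finite.iff_fg.1 inferInstance
  have hI : Module.FinitePresentation (MonoidAlgebra R S) I := by
    have : Module.FinitePresentation (MonoidAlgebra R S) (LinearMap.ker J'.mkQ) := by
      rwa [Submodule.ker_mkQ]
    exact Module.finitePresentation_of_ker J'.mkQ J'.mkQ_surjective
  exact ModuleFPn.of_surjective (augmentationLinear R S) (augmentationLinear_surjective R S)
    (moduleFPn_one_of_finitePresentation (M := I))

end Ascending

/-! ### Characters with discrete image -/

section Characters

variable {G : Type v} [Group G] (χ : Additive G →+ ℝ)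

/-- A nonzero real character with values in `(1/D)ℤ` has a positive generator of its image. -/
theorem exists_generator_of_discrete (hχ : χ ≠ 0) {D : ℕ} (hD : 0 < D)
    (h : ∀ g : G, ∃ k : ℤ, D * χ (Additive.ofMul g) = k) :
    ∃ t : G, 0 < χ (Additive.ofMul t) ∧
      ∀ g : G, ∃ n : ℤ, χ (Additive.ofMul g) = n * χ (Additive.ofMul t) := by
  have hD' : (0 : ℝ) < D := by exact_mod_cast hD
  -- Values in `(1/D)ℤ` leave the interval `(0, 1/D)` empty, so the image is cyclic.
  obtain ⟨b, hb⟩ := AddSubgroup.cyclic_of_isolated_zero (H := χ.range) (a := 1 / (D : ℝ))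
    (by positivity) (by
      rw [Set.disjoint_left]
      rintro _ ⟨g, rfl⟩ ⟨h0, h1⟩
      obtain ⟨k, hk⟩ := h g.toMul
      rw [ofMul_toMul] at hk
      rw [lt_div_iff₀ hD', mul_comm, hk] at h1
      have h0 : (0 : ℝ) < k := hk ▸ mul_pos hD' h0
      norm_cast at h0 h1
      omega)
  have hgen : ∀ g : G, ∃ n : ℤ, χ (Additive.ofMul g) = n * b := fun g => by
    have : χ (Additive.ofMul g) ∈ χ.range := ⟨_, rfl⟩
    rw [hb, AddSubgroup.mem_closure_singleton] at this
    obtain ⟨n, hn⟩ := this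
    exact ⟨n, by rw [← hn, zsmul_eq_mul]⟩
  have hb0 : b ≠ 0 := by
    rintro rfl
    refine hχ (AddMonoidHom.ext fun g => ?_)
    obtain ⟨n, hn⟩ := hgen g.toMul
    simpa using hn
  obtain ⟨t, ht⟩ : b ∈ χ.range := hb ▸ AddSubgroup.subset_closure rfl
  rcases lt_or_gt_of_ne hb0 with hneg | hpos
  · refine ⟨t.toMul⁻¹, ?_, fun g => ?_⟩
    · simpa [ht] using hneg
    · obtain ⟨n, hn⟩ := hgen g
      exact ⟨-n, by simp [hn, ht]⟩
  · exact ⟨t.toMul, by simpa [ht] using hpos, fun g => by simpa [ht] using hgen g⟩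

theorem exists_common_denominator {X : Type*} (T : Finset X) (f : X → ℝ)
    (h : ∀ x ∈ T, ∃ q : ℚ, f x = q) : ∃ D : ℕ, 0 < D ∧ ∀ x ∈ T, ∃ k : ℤ, D * f x = k := by
  classical
  induction T using Finset.induction_on with
  | empty => exact ⟨1, one_pos, by simp⟩
  | insert a T _ ih =>
    obtain ⟨D, hD, hDT⟩ := ih fun x hx => h x (Finset.mem_insert_of_mem hx)
    obtain ⟨q, hq⟩ := h a (Finset.mem_insert_self _ _)
    refine ⟨D * q.den, Nat.mul_pos hD q.den_pos, fun x hx => ?_⟩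
    rcases Finset.mem_insert.1 hx with rfl | hx
    · refine ⟨D * q.num, ?_⟩
      have : (q.den : ℝ) * q = q.num := by exact_mod_cast Rat.den_mul_eq_num q
      rw [hq]
      push_cast
      rw [mul_assoc, this]
    · obtain ⟨k, hk⟩ := hDT x hx
      refine ⟨q.den * k, ?_⟩
      push_cast
      rw [← hk]
      ring

end Characters

/-! ### Subgroups generated by boundedly many conjugates -/

section Engulfing

variable {G : Type v} [Group G]

/-- The subgroup generated by the conjugates `tⁿ k t⁻ⁿ`, `n ≤ N`, `k ∈ E`. -/
def conjClosure (t : G) (E : Set G) (N : ℕ) : Subgroup G :=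
  Subgroup.closure {g | ∃ n ≤ N, ∃ k ∈ E, g = t ^ n * k * (t ^ n)⁻¹}

theorem conjClosure_mono (t : G) (E : Set G) : Monotone (conjClosure t E) := fun _ _ h =>
  Subgroup.closure_mono fun _ ⟨n, hn, k, hk, hg⟩ => ⟨n, hn.trans h, k, hk, hg⟩

theorem conj_mem_conjClosure (t : G) {E : Set G} {n N : ℕ} (hn : n ≤ N) {k : G} (hk : k ∈ E) :
    t ^ n * k * (t ^ n)⁻¹ ∈ conjClosure t E N :=
  Subgroup.subset_closure ⟨n, hn, k, hk, rfl⟩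

theorem conjClosure_fg (t : G) {E : Set G} (hE : E.Finite) (N : ℕ) : (conjClosure t E N).FG := by
  rw [Subgroup.fg_iff]
  refine ⟨_, rfl, ?_⟩
  refine (Set.Finite.image2 (fun n k => t ^ n * k * (t ^ n)⁻¹) (Set.finite_Iic N) hE).subset ?_
  rintro _ ⟨n, hn, k, hk, rfl⟩
  exact ⟨n, hn, k, hk, rfl⟩

theorem conj_mem_of_closure {X : Set G} {B : Subgroup G} (x : G)
    (h : ∀ g ∈ X, x⁻¹ * g * x ∈ B) {g : G} (hg : g ∈ Subgroup.closure X) : x⁻¹ * g * x ∈ B := by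
  have : Subgroup.closure X ≤ B.comap (MulAut.conj x⁻¹).toMonoidHom := by
    rw [Subgroup.closure_le]
    intro g hg
    simpa using h g hg
  simpa using this hg

theorem conj_pow_mem {B : Subgroup G} {t : G} (h : ∀ b ∈ B, t⁻¹ * b * t ∈ B) (m : ℕ) :
    ∀ b ∈ B, (t ^ m)⁻¹ * b * t ^ m ∈ B := by
  induction m with
  | zero => simp
  | succ m ih =>
    intro b hb
    have := h _ (ih b hb)
    simpa [pow_succ, mul_assoc] using this

/-- Conjugating by `t⁻¹` lowers the exponent of a generator by one, so only the generators of
exponent `0`, namely `E`, need the hypothesis. -/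
theorem conj_mem_conjClosure_of_ascending {t : G} {E : Set G} {N : ℕ}
    (h : ∀ k ∈ E, t⁻¹ * k * t ∈ conjClosure t E N) :
    ∀ b ∈ conjClosure t E N, t⁻¹ * b * t ∈ conjClosure t E N := by
  intro b hb
  refine conj_mem_of_closure t ?_ hb
  rintro _ ⟨n, hn, k, hk, rfl⟩
  cases n with
  | zero => simpa using h k hk
  | succ n =>
    have := conj_mem_conjClosure t (Nat.le_of_succ_le hn) hk
    simpa [pow_succ', mul_assoc] using this

/-- A generator of exponent `n ≤ M` becomes `t^{-(M-n)} k t^{M-n}` with `k ∈ E`, which remains in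
the stable subgroup. -/
theorem conj_pow_mem_conjClosure {t : G} {E : Set G} {N : ℕ}
    (h : ∀ b ∈ conjClosure t E N, t⁻¹ * b * t ∈ conjClosure t E N) {M : ℕ} {g : G}
    (hg : g ∈ conjClosure t E M) : (t ^ M)⁻¹ * g * t ^ M ∈ conjClosure t E N := by
  refine conj_mem_of_closure (t ^ M) ?_ hg
  rintro _ ⟨n, hn, k, hk, rfl⟩
  have hk' : k ∈ conjClosure t E N := by
    simpa using conj_mem_conjClosure t (Nat.zero_le N) hk
  have := conj_pow_mem h (M - n) k hk'
  obtain ⟨m, rfl⟩ := Nat.exists_eq_add_of_le hn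
  rw [Nat.add_sub_cancel_left] at this
  simpa [pow_add, mul_assoc] using this

end Engulfing

/-! ### From `Σ¹` to `Σ²` -/

section Main

variable {R : Type u} [Ring R] [Nontrivial R] {G : Type v} [Group G] {χ : Additive G →+ ℝ}

/-- Rational values alone could have unbounded denominators. A common denominator on the finite set
`T` propagates to all of `G_χ` by saturation, and to `G` by inversion. -/
theorem exists_generator_of_mem_sigmaInvRat (h : χ ∈ sigmaInvRat G R 1) :
    ∃ t : G, 0 < χ (Additive.ofMul t) ∧
      ∀ g : G, ∃ n : ℤ, χ (Additive.ofMul g) = n * χ (Additive.ofMul t) := by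
  obtain ⟨⟨hχ, hFP⟩, hrat⟩ := h
  obtain ⟨T, hT⟩ := exists_finset_augmentationIdeal_eq_span hFP
  obtain ⟨D, hD, hDT⟩ := exists_common_denominator T
    (fun s => χ (Additive.ofMul (s : G))) fun s _ => hrat _
  have key := forall_of_augmentationIdeal_eq_span hT
    (fun s => ∃ k : ℤ, D * χ (Additive.ofMul (s : G)) = k) ⟨0, by simp⟩ (by
      intro x s hs
      obtain ⟨k, hk⟩ := hDT s hs
      rw [Submonoid.coe_mul, ofMul_mul, map_add, mul_add, hk]
      constructor
      · rintro ⟨l, hl⟩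
        exact ⟨l - k, by push_cast; linarith⟩
      · rintro ⟨l, hl⟩
        exact ⟨l + k, by push_cast; linarith⟩)
  refine exists_generator_of_discrete χ hχ hD fun g => ?_
  rcases le_total 0 (χ (Additive.ofMul g)) with hg | hg
  · exact key ⟨g, hg⟩
  · obtain ⟨k, hk⟩ := key ⟨g⁻¹, by
      change 0 ≤ χ (Additive.ofMul g⁻¹)
      rw [ofMul_inv, map_neg]
      linarith⟩
    refine ⟨-k, ?_⟩
    rw [Int.cast_neg, ← hk]
    simp

/-- If `χ ∈ Σ¹` has image generated by `χ(t) > 0`, then its kernel is the ascending union of the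
conjugates by powers of `t` of a finitely generated subgroup. -/
theorem exists_ascending_subgroup
    (hFP : ModuleFPn (MonoidAlgebra R (nonnegSubmonoid χ))
      (TrivialModule R (nonnegSubmonoid χ)) 1)
    {t : G} (ht : 0 < χ (Additive.ofMul t))
    (hgen : ∀ g : G, ∃ n : ℤ, χ (Additive.ofMul g) = n * χ (Additive.ofMul t)) :
    ∃ B : Subgroup G, B.FG ∧ (∀ b ∈ B, χ (Additive.ofMul b) = 0) ∧
      (∀ b ∈ B, t⁻¹ * b * t ∈ B) ∧
      ∀ s ∈ nonnegSubmonoid χ, ∃ n m : ℕ, ∃ b ∈ B, s * t ^ m = t ^ n * b := by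
  classical
  obtain ⟨T, hT⟩ := exists_finset_augmentationIdeal_eq_span hFP
  have hdeg : ∀ s ∈ nonnegSubmonoid χ, ∃ n : ℕ,
      χ (Additive.ofMul s) = n * χ (Additive.ofMul t) := by
    intro s hs
    obtain ⟨n, hn⟩ := hgen s
    have hs : 0 ≤ χ (Additive.ofMul s) := hs
    have : (0 : ℝ) ≤ n := by
      rw [hn] at hs
      exact nonneg_of_mul_nonneg_left hs ht
    lift n to ℕ using by exact_mod_cast this
    exact ⟨n, by simpa using hn⟩
  choose! d hd using hdeg
  have hχpow : ∀ n : ℕ, χ (Additive.ofMul (t ^ n)) = n * χ (Additive.ofMul t) := fun n => by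
    rw [ofMul_pow, map_nsmul, nsmul_eq_mul]
  have hcancel : ∀ {n m : ℕ}, (n : ℝ) * χ (Additive.ofMul t) = m * χ (Additive.ofMul t) →
      n = m := fun h => by exact_mod_cast mul_right_cancel₀ ht.ne' h
  have hdmul : ∀ x ∈ nonnegSubmonoid χ, ∀ y ∈ nonnegSubmonoid χ, d (x * y) = d x + d y := by
    intro x hx y hy
    apply hcancel
    rw [← hd _ (mul_mem hx hy), ofMul_mul, map_add, hd x hx, hd y hy]
    push_cast
    ring
  have hd0 : ∀ x, χ (Additive.ofMul x) = 0 → d x = 0 := fun x hx => by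
    apply hcancel
    rw [← hd x hx.ge, hx]
    simp
  -- The elements of `T`, shifted into the kernel of `χ` by powers of `t`.
  let E : Set G := (fun s : nonnegSubmonoid χ => (s : G) * (t ^ d s)⁻¹) '' T
  have hE : E.Finite := T.finite_toSet.image _
  have hχE : ∀ k ∈ E, χ (Additive.ofMul k) = 0 := by
    rintro _ ⟨s, -, rfl⟩
    simp only [ofMul_mul, ofMul_inv, map_add, map_neg, hχpow]
    rw [hd s s.2, add_neg_cancel]
  have hcover : ∀ s : nonnegSubmonoid χ, ∃ N, (s : G) * (t ^ d s)⁻¹ ∈ conjClosure t E N := by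
    refine forall_of_augmentationIdeal_eq_span hT
      (fun s => ∃ N, (s : G) * (t ^ d s)⁻¹ ∈ conjClosure t E N) ?_ ?_
    · exact ⟨0, by simp [hd0 1 (by simp)]⟩
    · intro x s hs
      have hk : (s : G) * (t ^ d s)⁻¹ ∈ E := ⟨s, hs, rfl⟩
      -- Passing from `x` to `x s` multiplies the shifted element by a conjugate of a member of `E`
      -- by `t ^ d x`, so membership is saturated once `N` may grow.
      have heq : ((x * s : nonnegSubmonoid χ) : G) * (t ^ d ((x * s : nonnegSubmonoid χ) : G))⁻¹ =
          (x : G) * (t ^ d x)⁻¹ * (t ^ d x * ((s : G) * (t ^ d s)⁻¹) * (t ^ d x)⁻¹) := by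
        rw [Submonoid.coe_mul, hdmul x x.2 s s.2, add_comm, pow_add]
        group
      simp only [heq]
      constructor
      · rintro ⟨N, hN⟩
        refine ⟨max N (d x), ?_⟩
        exact ((conjClosure t E _).mul_mem_cancel_right
          (conj_mem_conjClosure t (le_max_right _ _) hk)).1
          (conjClosure_mono t E (le_max_left _ _) hN)
      · rintro ⟨N, hN⟩
        refine ⟨max N (d x), ?_⟩
        exact ((conjClosure t E _).mul_mem_cancel_right
          (conj_mem_conjClosure t (le_max_right _ _) hk)).2
          (conjClosure_mono t E (le_max_left _ _) hN)
  have hker : ∀ g : G, χ (Additive.ofMul g) = 0 → ∃ N, g ∈ conjClosure t E N := fun g hg => by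
    simpa [hd0 g hg] using hcover ⟨g, hg.ge⟩
  have hconj : ∀ g : G, χ (Additive.ofMul g) = 0 → χ (Additive.ofMul (t⁻¹ * g * t)) = 0 :=
    fun g hg => by simp [ofMul_mul, ofMul_inv, hg]
  choose! N hN using hker
  -- Large enough to contain `t⁻¹ k t` for each of the finitely many `k ∈ E`.
  let N₀ := hE.toFinset.sup fun k => N (t⁻¹ * k * t)
  have hasc := conj_mem_conjClosure_of_ascending (t := t) (E := E) (N := N₀) fun k hk =>
    conjClosure_mono t E
      (Finset.le_sup (f := fun k => N (t⁻¹ * k * t)) (hE.mem_toFinset.2 hk))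
      (hN _ (hconj k (hχE k hk)))
  refine ⟨conjClosure t E N₀, conjClosure_fg t hE _, fun b hb => ?_, hasc, fun s hs => ?_⟩
  · induction hb using Subgroup.closure_induction with
    | mem x hx =>
      obtain ⟨n, -, k, hk, rfl⟩ := hx
      simp [ofMul_mul, ofMul_inv, hχE k hk]
    | one => simp
    | mul x y _ _ hx hy => rw [ofMul_mul, map_add, hx, hy, add_zero]
    | inv x _ hx => rw [ofMul_inv, map_neg, hx, neg_zero]
  · have hg : χ (Additive.ofMul ((t ^ d s)⁻¹ * s)) = 0 := by
      rw [ofMul_mul, ofMul_inv, map_add, map_neg, hχpow, hd s hs, neg_add_cancel]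
    -- Write `s = t^d g` with `χ(g) = 0` and `g` of level `N`; then `b = t^{-N} g t^N` lies in the
    -- subgroup and `s t^N = t^{d+N} b`.
    refine ⟨d s + N ((t ^ d s)⁻¹ * s), N ((t ^ d s)⁻¹ * s), _,
      conj_pow_mem_conjClosure hasc (hN _ hg), ?_⟩
    rw [pow_add]
    group

theorem sigmaInvRat_one_subset_two (hcoh : HomologicallyCoherent R G) :
    sigmaInvRat G R 1 ⊆ sigmaInvRat G R 2 := by
  intro χ h
  obtain ⟨t, ht, hgen⟩ := exists_generator_of_mem_sigmaInvRat h
  obtain ⟨B, hfg, hχB, htB, hS⟩ := exists_ascending_subgroup h.1.2 ht hgen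
  exact ⟨⟨h.1.1, moduleFPn_two_of_ascending R _ B χ t (fun b hb => (hχB b hb).ge) hχB htB ht.le
    ht hS (hcoh B hfg)⟩, h.2⟩

end Main

end SigmaCoherence

end

theorem mainTheorem12 {R : Type*} [Ring R] {G : Type*} [Group G]
    (hFP : SigmaCoherence.GroupFP R G)
    (hcd : SigmaCoherence.cohomDim R G ≤ 2)
    (hcoh : SigmaCoherence.HomologicallyCoherent R G) :
    SigmaCoherence.sigmaInvRat G R 1 = SigmaCoherence.sigmaInvRat G R 2 := by
  apply Set.Subset.antisymm
  -- The saturation principle needs `1 ≠ 0` in `R`; over the zero ring every module is of type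
  -- `FP₂`.
  · rcases subsingleton_or_nontrivial R with hR | hR
    · intro χ h
      have := MonoidAlgebra.coeff_injective
        (R := R) (M := SigmaCoherence.nonnegSubmonoid χ) |>.subsingleton
      exact ⟨⟨h.1.1, SigmaCoherence.moduleFPn_of_subsingleton_ring 2⟩, h.2⟩
    · exact SigmaCoherence.sigmaInvRat_one_subset_two hcoh
  · exact fun χ h => ⟨⟨h.1.1, h.1.2.mono one_le_two⟩, h.2⟩
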